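/- For a function $f:[n]\to[n]$, where $[n]=\{1,\dots,n\}$, let $G_f$ be the directed graph on $[n]$ with an edge $i\to j$ if and only if $f(i)=j$. A function $f:[n]\to[n]$ is called min-realizable in a metric space $(X,d)$ if it has no fixed points and there are points $A_1,\dots,A_n\in X$ such that the distances $d(A_i,A_j)$ are distinct for different pairs $\{i,j\}$ with $i\ne j$, and $d(A_i,A_{f(i)})\le d(A_i,A_j)$ for all distinct $i,j\in[n]$; it is called min-realizable if it is min-realizable in some metric space. The complete upward binary tree $B^s$ of depth $s$ is the directed graph with vertex set $\{(i,j) : 0\le i\le s,\ 1\le j\le 2^i\}$ and edges $(i+1,2j-1)\to(i,j)$ and $(i+1,2j)\to(i,j)$ for all $0\le i\le s-1$, $1\le j\le 2^i$. A directed graph contains a copy of $B^s$ if it has a (not necessarily induced) subgraph isomorphic to $B^s$. Let $k$ be a positive integer, and let $\mathbb{R}^k$ carry the Euclidean distance. Then there is an integer $s(k)\ge 0$ such that for every $n$, every function $f:[n]\to[n]$ and every $t\ge s(k)$: if $G_f$ contains a copy of $B^t$, then $f$ is not min-realizable in $\mathbb{R}^k$. Moreover, bounded in-degree does not guarantee min-realizability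 in $\mathbb{R}^k$: there are an $n$ and a min-realizable function $f:[n]\to[n]$ such that every vertex of $G_f$ has in-degree at most $2$, but $f$ is not min-realizable in $\mathbb{R}^k$. -/

import Mathlib

/-- The functional graph of `f : [n] → [n]`: there is an edge `i → j` iff `f i = j`. -/
def functionalGraph {n : ℕ} (f : Fin n → Fin n) : Digraph (Fin n) where
  Adj i j := f i = j

/-- Vertices of the complete upward binary tree of depth `s`:
pairs `(i, j)` with `0 ≤ i ≤ s` and `1 ≤ j ≤ 2 ^ i`. -/
abbrev UpTreeVertex (s : ℕ) : Type :=
  {p : ℕ × ℕ // p.1 ≤ s ∧ 1 ≤ p.2 ∧ p.2 ≤ 2 ^ p.1}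

/-- The complete upward binary tree of depth `s`, with edges
`(i + 1, 2 j - 1) → (i, j)` and `(i + 1, 2 j) → (i, j)`. -/
def upTree (s : ℕ) : Digraph (UpTreeVertex s) where
  Adj u v := u.1.1 = v.1.1 + 1 ∧ (u.1.2 + 1 = 2 * v.1.2 ∨ u.1.2 = 2 * v.1.2)

/-- `G` contains a copy of `H`: a subgraph, not necessarily induced, isomorphic to `H`. -/
def ContainsDigraphCopy {V W : Type*} (G : Digraph V) (H : Digraph W) : Prop :=
  ∃ φ : W → V, Function.Injective φ ∧ ∀ u v : W, H.Adj u v → G.Adj (φ u) (φ v)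

/-- The number of vertices `w` with an edge `w → v`, in a finite digraph. -/
noncomputable def digraphInDegree {V : Type*} [Finite V] (G : Digraph V) (v : V) : ℕ :=
  {w : V | G.Adj w v}.ncard

/-- `f` has no fixed points, and there are points `A₁, …, Aₙ` of `X` whose distances are
distinct for distinct pairs of indices, such that `A_{f(i)}` is a closest point to `A_i` among
the others. -/
def MinRealizableIn {n : ℕ} (f : Fin n → Fin n) (X : Type*) [MetricSpace X] : Prop :=
  (∀ i, f i ≠ i) ∧
  ∃ A : Fin n → X,
    (∀ i j k l : Fin n, i ≠ j → k ≠ l →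
      dist (A i) (A j) = dist (A k) (A l) → s(i, j) = s(k, l)) ∧
    (∀ i j : Fin n, i ≠ j → dist (A i) (A (f i)) ≤ dist (A i) (A j))

/-- `f` is min-realizable in some metric space. -/
def MinRealizable {n : ℕ} (f : Fin n → Fin n) : Prop :=
  ∃ (X : Type) (_ : MetricSpace X), MinRealizableIn f X

/-! Suppose a binary tree of depth `t` is realized in dimension `k`. Let the radius of a vertex be
its distance to its image under `f`, the nearest other point. Radii never decrease away from the
root, so a vertex of radius at most `R` lies within `tR` of the root. Two packing bounds follow: at
most `(8t²+1)^k` vertices have radius in `[R, 4tR]` (`card_le_of_radius_mem_Icc`), and at most `5^k`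
jump from a parent of radius at most `R` to a radius above `4tR` (`card_le_of_radius_gt`).

The frontier at threshold `S` consists of vertices of radius above `S` whose parent has radius at
most `S`; the two bounds cap its size. Raise `S` to `4t` times the smallest frontier radius. At most
`5^k` members survive; each other one is replaced by two vertices at most `L+1` levels further,
where `2^L > (8t²+1)^k`. Hence the excess over `5^k` at least doubles (`exists_isFrontier_larger`)
and passes the cap after boundedly many rounds. The depth needed is quadratic in `L`, so a suitable
`L` exists.

For the second claim, a binary tree hung on a 2-cycle has in-degrees at most 2 and is realized by a
metric whose distances all lie in `[K, 2K]`. -/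

/-! ### Volume packing -/

open Module MeasureTheory Metric in
-- The balls of radius `δ/2` about the points are disjoint and lie in the ball of radius `ρ + δ/2`;
-- compare volumes.
theorem card_le_of_separated_of_norm_le {ι E : Type*} [NormedAddCommGroup E] [NormedSpace ℝ E]
    [FiniteDimensional ℝ E] (s : Finset ι) (x : ι → E) {ρ δ : ℝ} (hδ : 0 < δ) (hρ : 0 ≤ ρ)
    (hx : ∀ i ∈ s, ‖x i‖ ≤ ρ) (hsep : ∀ i ∈ s, ∀ j ∈ s, i ≠ j → δ ≤ ‖x i - x j‖) :
    (s.card : ℝ) ≤ (2 * ρ / δ + 1) ^ finrank ℝ E := by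
  borelize E
  let μ : Measure E := Measure.addHaar
  have hδ' : (0 : ℝ) < δ / 2 := by positivity
  have hρ' : (0 : ℝ) < ρ + δ / 2 := by positivity
  set A : Set E := ⋃ i ∈ s, ball (x i) (δ / 2) with hA
  have hdisj : Set.Pairwise (s : Set ι) (Function.onFun Disjoint fun i => ball (x i) (δ / 2)) := by
    intro i hi j hj hij
    apply ball_disjoint_ball
    rw [dist_eq_norm]
    have := hsep i hi j hj hij
    linarith
  have hsub : A ⊆ ball (0 : E) (ρ + δ / 2) := by
    refine Set.iUnion₂_subset fun i hi => ball_subset_ball' ?_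
    rw [dist_zero_right]
    linarith [hx i hi]
  have key : (s.card : ENNReal) * ENNReal.ofReal ((δ / 2) ^ finrank ℝ E) * μ (ball 0 1) ≤
      ENNReal.ofReal ((ρ + δ / 2) ^ finrank ℝ E) * μ (ball 0 1) :=
    calc
      (s.card : ENNReal) * ENNReal.ofReal ((δ / 2) ^ finrank ℝ E) * μ (ball 0 1) = μ A := by
        rw [hA, measure_biUnion_finset hdisj fun c _ => measurableSet_ball]
        simp only [μ.addHaar_ball_of_pos _ hδ', Finset.sum_const, nsmul_eq_mul, mul_assoc]
      _ ≤ μ (ball (0 : E) (ρ + δ / 2)) := measure_mono hsub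
      _ = ENNReal.ofReal ((ρ + δ / 2) ^ finrank ℝ E) * μ (ball 0 1) := by
        rw [μ.addHaar_ball_of_pos _ hρ']
  have hpos : μ (ball (0 : E) 1) ≠ 0 := (measure_ball_pos _ _ zero_lt_one).ne'
  have hfin : μ (ball (0 : E) 1) ≠ ⊤ := measure_ball_lt_top.ne
  have key' := (ENNReal.mul_le_mul_iff_left hpos hfin).1 key
  rw [← ENNReal.ofReal_natCast, ← ENNReal.ofReal_mul (by positivity),
    ENNReal.ofReal_le_ofReal_iff (by positivity)] at key'
  have : 2 * ρ / δ + 1 = (ρ + δ / 2) / (δ / 2) := by field_simp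
  rw [this, div_pow, le_div_iff₀ (by positivity)]
  exact key'

/-! ### Nearest-parent trees and their two packing bounds -/

/-- Points `x u` and radii `r u` attached to the vertices of a complete binary tree of depth `t`
(encoded as boolean lists, the children of `u` being `b :: u`), such that `r u` is the distance from
`x u` to a closest other point, which is the point of the parent if `u` is not the root. -/
structure IsNearestParentTree {E : Type*} [NormedAddCommGroup E] (t : ℕ) (x : List Bool → E)
    (r : List Bool → ℝ) : Prop where
  pos : ∀ u, u.length ≤ t → 0 < r u
  norm_sub_parent : ∀ b u, (b :: u).length ≤ t → ‖x (b :: u) - x u‖ = r (b :: u)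
  le_norm_sub : ∀ u v, u.length ≤ t → v.length ≤ t → u ≠ v → r u ≤ ‖x u - x v‖

namespace IsNearestParentTree

variable {E : Type*} [NormedAddCommGroup E] {t : ℕ} {x : List Bool → E} {r : List Bool → ℝ}

theorem radius_le_cons (h : IsNearestParentTree t x r) {b : Bool} {u : List Bool}
    (hu : (b :: u).length ≤ t) : r u ≤ r (b :: u) := by
  have hu' : u.length ≤ t := by simp at hu; omega
  rw [← h.norm_sub_parent b u hu, norm_sub_rev]
  exact h.le_norm_sub u (b :: u) hu' hu (by simp)

theorem radius_le_of_suffix (h : IsNearestParentTree t x r) {u v : List Bool} (huv : u <:+ v)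
    (hv : v.length ≤ t) : r u ≤ r v := by
  obtain ⟨l, rfl⟩ := huv
  induction l with
  | nil => simp
  | cons b l ih =>
    have hl : (l ++ u).length ≤ t := by simp at hv ⊢; omega
    exact (ih hl).trans (h.radius_le_cons hv)

theorem norm_sub_root_le (h : IsNearestParentTree t x r) (u : List Bool) (hu : u.length ≤ t) :
    ‖x u - x []‖ ≤ u.length * r u := by
  induction u with
  | nil => simp
  | cons b u ih =>
    have hu' : u.length ≤ t := by simp at hu; omega
    have h1 := norm_sub_le_norm_sub_add_norm_sub (x (b :: u)) (x u) (x [])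
    rw [h.norm_sub_parent b u hu] at h1
    have h2 : (u.length : ℝ) * r u ≤ u.length * r (b :: u) :=
      mul_le_mul_of_nonneg_left (h.radius_le_cons hu) (by positivity)
    have h3 := ih hu'
    push_cast [List.length_cons]
    linarith

theorem norm_sub_root_le_depth_mul (h : IsNearestParentTree t x r) {u : List Bool} {R : ℝ}
    (hu : u.length ≤ t) (hR : r u ≤ R) : ‖x u - x []‖ ≤ t * R := by
  have h0 := h.pos u hu
  have : (u.length : ℝ) ≤ t := by exact_mod_cast hu
  exact (h.norm_sub_root_le u hu).trans (by gcongr)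

variable [NormedSpace ℝ E] [FiniteDimensional ℝ E]

theorem card_le_of_radius_mem_Icc (h : IsNearestParentTree t x r) {R : ℝ} (hR : 0 < R)
    (s : Finset (List Bool)) (hs : ∀ u ∈ s, u.length ≤ t ∧ R ≤ r u ∧ r u ≤ 4 * t * R) :
    s.card ≤ (8 * t ^ 2 + 1) ^ Module.finrank ℝ E := by
  have := card_le_of_separated_of_norm_le s (fun u => x u - x []) hR
    (ρ := t * (4 * t * R)) (by positivity)
    (fun u hu => h.norm_sub_root_le_depth_mul (hs u hu).1 (hs u hu).2.2)
    (fun u hu v hv huv => by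
      rw [sub_sub_sub_cancel_right]
      exact (hs u hu).2.1.trans (h.le_norm_sub u v (hs u hu).1 (hs v hv).1 huv))
  have e : 2 * (t * (4 * t * R)) / R + 1 = (8 * t ^ 2 + 1 : ℝ) := by field_simp; ring
  rw [e] at this
  exact_mod_cast this

/-- All parents lie within `tR` of the root, negligible against radii above `4tR`. The long edges
thus nearly share an endpoint, and separation of their far ends forces their unit directions to be
`1/2`-separated. -/
theorem card_le_of_radius_gt (h : IsNearestParentTree t x r) {R : ℝ}
    (s : Finset (List Bool))
    (hs : ∀ u ∈ s, u ≠ [] ∧ u.length ≤ t ∧ r u.tail ≤ R ∧ 4 * t * R < r u) :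
    s.card ≤ 5 ^ Module.finrank ℝ E := by
  have hpar : ∀ u ∈ s, ‖x u - x u.tail‖ = r u := by
    intro u hu
    obtain ⟨hne, hl, -, -⟩ := hs u hu
    cases u with
    | nil => exact absurd rfl hne
    | cons b u => exact h.norm_sub_parent b u hl
  have hroot : ∀ u ∈ s, ‖x u.tail - x []‖ ≤ t * R := fun u hu =>
    h.norm_sub_root_le_depth_mul (by have := (hs u hu).2.1; simp; omega) (hs u hu).2.2.1
  have main : ∀ u ∈ s, ∀ v ∈ s, u ≠ v → r v ≤ r u →
      (1 / 2 : ℝ) ≤ ‖(r u)⁻¹ • (x u - x u.tail) - (r v)⁻¹ • (x v - x v.tail)‖ := by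
    intro u hu v hv huv hle
    obtain ⟨-, hlu, -, -⟩ := hs u hu
    obtain ⟨-, hlv, -, hv4⟩ := hs v hv
    have hu0 := h.pos u hlu
    have hv0 := h.pos v hlv
    set a := x u - x u.tail with ha
    set b := x v - x v.tail with hb
    have e1 : ‖a - b‖ ≥ r u - 2 * (t * R) := by
      have h1 := h.le_norm_sub u v hlu hlv huv
      have e : x u - x v = (a - b) + ((x u.tail - x []) - (x v.tail - x [])) := by
        rw [ha, hb]; abel
      have h2 := norm_add_le (a - b) ((x u.tail - x []) - (x v.tail - x []))
      have h3 := norm_sub_le (x u.tail - x []) (x v.tail - x [])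
      rw [← e] at h2
      linarith [hroot u hu, hroot v hv]
    -- Shrink `a` to the length of `b`: this costs `r u - r v`, and what remains is `r v` times the
    -- difference of unit directions.
    have e2 : a - b = (1 - r v * (r u)⁻¹) • a + r v • ((r u)⁻¹ • a - (r v)⁻¹ • b) := by
      rw [smul_sub (r v), smul_smul, smul_smul, mul_inv_cancel₀ hv0.ne', sub_smul, one_smul, one_smul]
      abel
    have e3 : ‖(1 - r v * (r u)⁻¹) • a‖ = r u - r v := by
      have : 0 ≤ 1 - r v * (r u)⁻¹ := by
        rw [← div_eq_mul_inv, sub_nonneg, div_le_one hu0]; exact hle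
      rw [norm_smul, Real.norm_of_nonneg this, hpar u hu]
      field_simp
    have e4 := norm_add_le ((1 - r v * (r u)⁻¹) • a) (r v • ((r u)⁻¹ • a - (r v)⁻¹ • b))
    rw [← e2, e3, norm_smul, Real.norm_of_nonneg hv0.le] at e4
    have e5 : r v * (1 / 2) ≤ r v * ‖(r u)⁻¹ • a - (r v)⁻¹ • b‖ := by linarith
    exact le_of_mul_le_mul_left e5 hv0
  have := card_le_of_separated_of_norm_le s (fun u => (r u)⁻¹ • (x u - x u.tail))
    (δ := 1 / 2) (ρ := 1) (by norm_num) (by norm_num)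
    (fun u hu => by
      have hu0 := h.pos u (hs u hu).2.1
      rw [norm_smul, hpar u hu, Real.norm_of_nonneg (by positivity), inv_mul_cancel₀ hu0.ne'])
    (fun u hu v hv huv => by
      rcases le_total (r v) (r u) with hle | hle
      · exact main u hu v hv huv hle
      · rw [norm_sub_rev]
        exact main v hv u hu huv.symm hle)
  norm_num at this
  exact_mod_cast this

end IsNearestParentTree

/-! ### Growth of frontiers -/

/-- The vertices of `F` have depth at most `D`, and each of them lies just outside the subtree of
the vertices of radius at most `S`. -/
def IsFrontier (r : List Bool → ℝ) (D : ℕ) (S : ℝ) (F : Finset (List Bool)) : Prop :=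
  ∀ u ∈ F, u ≠ [] ∧ u.length ≤ D ∧ r u.tail ≤ S ∧ S < r u

namespace IsNearestParentTree

variable {E : Type*} [NormedAddCommGroup E] {t : ℕ} {x : List Bool → E} {r : List Bool → ℝ}

/-- A frontier is an antichain: a proper ancestor of `v` is an ancestor of its parent, so by
monotonicity has radius at most `S`. -/
theorem eq_of_suffix_of_isFrontier (h : IsNearestParentTree t x r) {D : ℕ} {S : ℝ}
    {F : Finset (List Bool)} (hF : IsFrontier r D S F) (hD : D ≤ t) {u v : List Bool}
    (hu : u ∈ F) (hv : v ∈ F) (huv : u <:+ v) : u = v := by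
  obtain ⟨hne, hl, hp, -⟩ := hF v hv
  cases v with
  | nil => exact absurd rfl hne
  | cons b v =>
    rcases List.suffix_cons_iff.1 huv with h1 | h1
    · exact h1
    · have := h.radius_le_of_suffix h1 (by simp at hl; omega)
      have h2 := (hF u hu).2.2.2
      simp only [List.tail_cons] at hp
      linarith

theorem exists_crossing_of_lt_radius {w : List Bool} {S : ℝ} (hw : r w ≤ S) (b : Bool)
    (l : List Bool) (hl : S < r (l ++ b :: w)) :
    ∃ l' : List Bool, l'.length ≤ l.length ∧ r (l' ++ b :: w).tail ≤ S ∧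
      S < r (l' ++ b :: w) := by
  induction l with
  | nil => exact ⟨[], le_rfl, by simpa using hw, hl⟩
  | cons c l ih =>
    by_cases hc : S < r (l ++ b :: w)
    · obtain ⟨l', h1, h2⟩ := ih hc
      exact ⟨l', h1.trans (by simp), h2⟩
    · exact ⟨c :: l, le_rfl, by simpa using hc, hl⟩

variable [NormedSpace ℝ E] [FiniteDimensional ℝ E]

/-- Otherwise all `2^L` descendants `L` levels further would have radius in `[R, 4tR]`, too many for
the packing bound. -/
theorem exists_descendant_radius_gt (h : IsNearestParentTree t x r) {L : ℕ}
    (hL : (8 * t ^ 2 + 1) ^ Module.finrank ℝ E < 2 ^ L) {R : ℝ} (hR : 0 < R) {w : List Bool}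
    (hw : w.length + L ≤ t) (hRw : R ≤ r w) :
    ∃ l : List Bool, l.length = L ∧ 4 * t * R < r (l ++ w) := by
  by_contra! hcon
  let g : List.Vector Bool L → List Bool := fun l => l.1 ++ w
  have hg : Function.Injective g := fun a b hab => Subtype.ext (List.append_cancel_right hab)
  have hcard := h.card_le_of_radius_mem_Icc hR (Finset.univ.image g) (by
    intro u hu
    obtain ⟨l, -, rfl⟩ := Finset.mem_image.1 hu
    have hlen : (l.1 ++ w).length ≤ t := by rw [List.length_append, l.2]; omega
    exact ⟨hlen, hRw.trans (h.radius_le_of_suffix (List.suffix_append _ _) hlen),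
      hcon l.1 l.2⟩)
  rw [Finset.card_image_of_injective _ hg, Finset.card_univ, card_vector, Fintype.card_bool]
    at hcard
  omega

theorem exists_crossing_below (h : IsNearestParentTree t x r) {L : ℕ}
    (hL : (8 * t ^ 2 + 1) ^ Module.finrank ℝ E < 2 ^ L) {R : ℝ} (hR : 0 < R) {w : List Bool}
    (hw : w.length + (L + 1) ≤ t) (hRw : R ≤ r w) (hwR : r w ≤ 4 * t * R) (b : Bool) :
    ∃ u : List Bool, (b :: w) <:+ u ∧ u.length ≤ w.length + (L + 1) ∧ r u.tail ≤ 4 * t * R ∧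
      4 * t * R < r u := by
  have hlen : (b :: w).length ≤ t := by simp; omega
  obtain ⟨l, hl, hlt⟩ := h.exists_descendant_radius_gt hL hR (w := b :: w) (by simp; omega)
    (hRw.trans (h.radius_le_cons hlen))
  obtain ⟨l', h1, h2⟩ := exists_crossing_of_lt_radius hwR b l hlt
  exact ⟨l' ++ b :: w, List.suffix_append _ _, by simp; omega, h2⟩

theorem card_le_of_isFrontier (h : IsNearestParentTree t x r) {D : ℕ} {S : ℝ} (hS : 0 < S)
    {F : Finset (List Bool)} (hF : IsFrontier r D S F) (hD : D ≤ t) :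
    F.card ≤ 5 ^ Module.finrank ℝ E + (8 * t ^ 2 + 1) ^ Module.finrank ℝ E := by
  classical
  rw [← Finset.card_filter_add_card_filter_not (s := F) (fun u => 4 * t * S < r u)]
  refine add_le_add (h.card_le_of_radius_gt (R := S) _ ?_) (h.card_le_of_radius_mem_Icc hS _ ?_)
  · intro u hu
    obtain ⟨hu, h4⟩ := Finset.mem_filter.1 hu
    obtain ⟨h1, h2, h3, -⟩ := hF u hu
    exact ⟨h1, h2.trans hD, h3, h4⟩
  · intro u hu
    obtain ⟨hu, h4⟩ := Finset.mem_filter.1 hu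
    obtain ⟨-, h2, -, h5⟩ := hF u hu
    exact ⟨h2.trans hD, h5.le, not_lt.1 h4⟩

theorem exists_isFrontier_nonempty (h : IsNearestParentTree t x r) {L : ℕ}
    (hL : (8 * t ^ 2 + 1) ^ Module.finrank ℝ E < 2 ^ L) (ht : L + 1 ≤ t) :
    ∃ (S : ℝ) (F : Finset (List Bool)), 0 < S ∧ IsFrontier r (L + 1) S F ∧ F.Nonempty := by
  have h0 := h.pos [] (by simp)
  have ht1 : (1 : ℝ) ≤ t := by exact_mod_cast (by omega : 1 ≤ t)
  obtain ⟨u, hs, hl, h1, h2⟩ := h.exists_crossing_below hL h0 (w := []) (by simpa using ht)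
    le_rfl (by nlinarith) true
  refine ⟨4 * t * r [], {u}, by positivity, ?_, Finset.singleton_nonempty u⟩
  intro v hv
  rw [Finset.mem_singleton.1 hv]
  refine ⟨?_, by simpa using hl, h1, h2⟩
  rintro rfl
  simp at hs

theorem exists_isFrontier_larger (h : IsNearestParentTree t x r) {L D : ℕ}
    (hL : (8 * t ^ 2 + 1) ^ Module.finrank ℝ E < 2 ^ L) (hD : D + (L + 1) ≤ t) {S : ℝ}
    (hS : 0 < S) {F : Finset (List Bool)} (hF : IsFrontier r D S F) (hne : F.Nonempty) :
    ∃ (S' : ℝ) (F' : Finset (List Bool)), 0 < S' ∧ IsFrontier r (D + (L + 1)) S' F' ∧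
      F.card + 1 ≤ F'.card ∧ 2 * F.card ≤ F'.card + 5 ^ Module.finrank ℝ E := by
  classical
  obtain ⟨m, hm, hmin⟩ := F.exists_min_image r hne
  have hSm : S < r m := (hF m hm).2.2.2
  have hR : 0 < r m := hS.trans hSm
  have ht1 : (1 : ℝ) ≤ t := by exact_mod_cast (by omega : 1 ≤ t)
  have hmm : r m ≤ 4 * t * r m := by nlinarith
  set S' : ℝ := 4 * t * r m with hS'
  set U := F.filter fun u => S' < r u with hU
  set B := F.filter fun u => ¬ S' < r u with hB
  have hcard : U.card + B.card = F.card := Finset.card_filter_add_card_filter_not _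
  have hUcard : U.card ≤ 5 ^ Module.finrank ℝ E := by
    refine h.card_le_of_radius_gt (R := r m) U fun u hu => ?_
    obtain ⟨hu, h4⟩ := Finset.mem_filter.1 hu
    obtain ⟨h1, h2, h3, -⟩ := hF u hu
    exact ⟨h1, by omega, h3.trans hSm.le, h4⟩
  have hBcard : 1 ≤ B.card :=
    Finset.card_pos.2 ⟨m, Finset.mem_filter.2 ⟨hm, not_lt.2 hmm⟩⟩
  -- The membership condition sits under the existential so that `choose` gives a total function;
  -- the value outside `B` is irrelevant.
  have hex : ∀ (w : List Bool) (b : Bool), ∃ u : List Bool, w ∈ B →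
      (b :: w) <:+ u ∧ u.length ≤ w.length + (L + 1) ∧ r u.tail ≤ S' ∧ S' < r u := by
    intro w b
    by_cases hw : w ∈ B
    · obtain ⟨hwF, h4⟩ := Finset.mem_filter.1 hw
      have hlen := (hF w hwF).2.1
      obtain ⟨u, hu⟩ := h.exists_crossing_below hL hR (w := w) (by omega) (hmin w hwF)
        (not_lt.1 h4) b
      exact ⟨u, fun _ => hu⟩
    · exact ⟨[], fun h => absurd h hw⟩
  choose g hg using hex
  have hBF : ∀ w ∈ B, w ∈ F := fun w hw => (Finset.mem_filter.1 hw).1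
  have hsuf : ∀ w ∈ B, ∀ b, w <:+ g w b := fun w hw b =>
    (List.suffix_cons b w).trans (hg w b hw).1
  -- Two ancestors of one vertex are comparable, so the antichain property gives `w = w'`; then `b
  -- :: w` and `b' :: w` are equally long suffixes of one list.
  have hinj : Set.InjOn (fun p : List Bool × Bool => g p.1 p.2)
      (B ×ˢ (Finset.univ : Finset Bool) : Finset (List Bool × Bool)) := by
    rintro ⟨w, b⟩ hp ⟨w', b'⟩ hp' heq
    simp only [Finset.coe_product, Set.mem_prod, Finset.mem_coe, Finset.coe_univ, Set.mem_univ,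
      and_true] at hp hp' heq
    have hww : w = w' := by
      rcases List.suffix_or_suffix_of_suffix (hsuf w hp b) (heq ▸ hsuf w' hp' b') with h1 | h1
      · exact h.eq_of_suffix_of_isFrontier hF (by omega) (hBF w hp) (hBF w' hp') h1
      · exact (h.eq_of_suffix_of_isFrontier hF (by omega) (hBF w' hp') (hBF w hp) h1).symm
    subst hww
    have h1 := (hg w b hp).1
    have h2 := (hg w b' hp).1
    rw [← heq] at h2
    have := List.IsSuffix.eq_of_length
      (List.suffix_of_suffix_length_le h1 h2 (by simp)) (by simp)
    simp only [List.cons.injEq, and_true] at this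
    rw [this]
  set N := (B ×ˢ (Finset.univ : Finset Bool)).image (fun p : List Bool × Bool => g p.1 p.2) with hN
  have hNcard : N.card = 2 * B.card := by
    rw [hN, Finset.card_image_of_injOn hinj, Finset.card_product, Finset.card_univ,
      Fintype.card_bool, mul_comm]
  have hdisj : Disjoint U N := by
    rw [Finset.disjoint_left]
    intro u hu hu'
    obtain ⟨⟨w, b⟩, hp, rfl⟩ := Finset.mem_image.1 hu'
    have hw : w ∈ B := (Finset.mem_product.1 hp).1
    obtain ⟨huF, h4⟩ := Finset.mem_filter.1 hu
    have := h.eq_of_suffix_of_isFrontier hF (by omega) (hBF w hw) huF (hsuf w hw b)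
    rw [hB, this] at hw
    exact (Finset.mem_filter.1 hw).2 h4
  refine ⟨S', U ∪ N, by positivity, ?_, ?_, ?_⟩
  · intro u hu
    rcases Finset.mem_union.1 hu with hu | hu
    · obtain ⟨huF, h4⟩ := Finset.mem_filter.1 hu
      obtain ⟨h1, h2, h3, -⟩ := hF u huF
      exact ⟨h1, by omega, by linarith, h4⟩
    · obtain ⟨⟨w, b⟩, hp, rfl⟩ := Finset.mem_image.1 hu
      have hw : w ∈ B := (Finset.mem_product.1 hp).1
      obtain ⟨h1, h2, h3, h4⟩ := hg w b hw
      have := (hF w (hBF w hw)).2.1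
      refine ⟨fun h0 => ?_, by dsimp only; omega, h3, h4⟩
      dsimp only at h0
      rw [h0] at h1
      simp at h1
  · rw [Finset.card_union_of_disjoint hdisj]; omega
  · rw [Finset.card_union_of_disjoint hdisj]; omega

theorem exists_isFrontier_card_ge (h : IsNearestParentTree t x r) {L : ℕ}
    (hL : (8 * t ^ 2 + 1) ^ Module.finrank ℝ E < 2 ^ L) (m : ℕ) (hm : (m + 1) * (L + 1) ≤ t) :
    ∃ (S : ℝ) (F : Finset (List Bool)), 0 < S ∧ IsFrontier r ((m + 1) * (L + 1)) S F ∧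
      m + 1 ≤ F.card := by
  induction m with
  | zero =>
    obtain ⟨S, F, h1, h2, h3⟩ := h.exists_isFrontier_nonempty hL (by omega)
    exact ⟨S, F, h1, by simpa using h2, Finset.card_pos.2 h3⟩
  | succ m ih =>
    rw [Nat.succ_mul] at hm ⊢
    obtain ⟨S, F, h1, h2, h3⟩ := ih (by omega)
    obtain ⟨S', F', h4, h5, h6, -⟩ := h.exists_isFrontier_larger hL hm h1 h2
      (Finset.card_pos.1 (by omega))
    exact ⟨S', F', h4, h5, by omega⟩

/-- Doubling helps only above `5^k`, with `k` the dimension; growth by one per round first brings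
the size to `5^k + 1`. -/
theorem exists_isFrontier_card_ge_two_pow (h : IsNearestParentTree t x r) {L : ℕ}
    (hL : (8 * t ^ 2 + 1) ^ Module.finrank ℝ E < 2 ^ L) (j : ℕ)
    (hj : (5 ^ Module.finrank ℝ E + j + 1) * (L + 1) ≤ t) :
    ∃ (S : ℝ) (F : Finset (List Bool)), 0 < S ∧
      IsFrontier r ((5 ^ Module.finrank ℝ E + j + 1) * (L + 1)) S F ∧
      5 ^ Module.finrank ℝ E + 2 ^ j ≤ F.card := by
  induction j with
  | zero => simpa using h.exists_isFrontier_card_ge hL _ hj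
  | succ j ih =>
    rw [← add_assoc, Nat.succ_mul] at hj ⊢
    obtain ⟨S, F, h1, h2, h3⟩ := ih (by omega)
    obtain ⟨S', F', h4, h5, -, h6⟩ := h.exists_isFrontier_larger hL hj h1 h2
      (Finset.card_pos.1 (lt_of_lt_of_le (by positivity) h3))
    exact ⟨S', F', h4, h5, by rw [pow_succ]; omega⟩

end IsNearestParentTree

theorem not_isNearestParentTree {E : Type*} [NormedAddCommGroup E] [NormedSpace ℝ E]
    [FiniteDimensional ℝ E] {t L : ℕ} (hL : (8 * t ^ 2 + 1) ^ Module.finrank ℝ E < 2 ^ L)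
    (ht : (5 ^ Module.finrank ℝ E + L + 1) * (L + 1) ≤ t) (x : List Bool → E)
    (r : List Bool → ℝ) : ¬ IsNearestParentTree t x r := by
  intro h
  obtain ⟨S, F, h1, h2, h3⟩ := h.exists_isFrontier_card_ge_two_pow hL L ht
  have := h.card_le_of_isFrontier h1 h2 ht
  omega

/-! ### Choice of the depth -/

theorem exists_pow_lt_two_pow (k C : ℕ) :
    ∃ L : ℕ, (8 * ((C + L + 1) * (L + 1)) ^ 2 + 1) ^ k < 2 ^ L := by
  have h1 := (tendsto_pow_const_div_const_pow_of_one_lt (5 * k) (one_lt_two (α := ℝ))).eventually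
    (gt_mem_nhds one_pos)
  -- `L ≥ C + 129` gives `C + L + 1 ≤ 2L` and absorbs the factor `129 = 8·16 + 1` below.
  obtain ⟨L, hlt, hL⟩ := (h1.and (Filter.eventually_ge_atTop (C + 129))).exists
  refine ⟨L, ?_⟩
  rw [div_lt_one (by positivity)] at hlt
  have h2 : L ^ (5 * k) < 2 ^ L := by exact_mod_cast hlt
  refine lt_of_le_of_lt ?_ h2
  rw [pow_mul]
  refine Nat.pow_le_pow_left ?_ k
  have h3 : (C + L + 1) * (L + 1) ≤ (2 * L) * (2 * L) :=
    Nat.mul_le_mul (by omega) (by omega)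
  calc 8 * ((C + L + 1) * (L + 1)) ^ 2 + 1 ≤ 8 * ((2 * L) * (2 * L)) ^ 2 + L ^ 4 := by
        gcongr
        exact Nat.one_le_pow _ _ (by omega)
    _ = 129 * L ^ 4 := by ring
    _ ≤ L * L ^ 4 := Nat.mul_le_mul_right _ (by omega)
    _ = L ^ 5 := by ring

/-! ### From copies of the tree to nearest-parent trees -/

/-- The number with binary digits `u`, the last digit first. -/
def binaryCode : List Bool → ℕ
  | [] => 0
  | b :: u => 2 * binaryCode u + b.toNat

theorem binaryCode_lt (u : List Bool) : binaryCode u < 2 ^ u.length := by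
  induction u with
  | nil => simp [binaryCode]
  | cons b u ih =>
    have := Bool.toNat_le b
    rw [binaryCode, List.length_cons, pow_succ]
    omega

theorem eq_of_binaryCode_eq {u v : List Bool} (hl : u.length = v.length)
    (h : binaryCode u = binaryCode v) : u = v := by
  induction u generalizing v with
  | nil => exact (List.length_eq_zero_iff.1 hl.symm).symm
  | cons b u ih =>
    cases v with
    | nil => simp at hl
    | cons c v =>
      simp only [binaryCode] at h
      have hb := Bool.toNat_le b
      have hc := Bool.toNat_le c
      have hbc : b = c := by cases b <;> cases c <;> simp at h ⊢ <;> omega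
      rw [ih (by simpa using hl) (by omega), hbc]

/-- The vertex of `upTree t` encoded by a boolean list of length at most `t`. -/
def upTreeVertexOfList {t : ℕ} (u : List Bool) (hu : u.length ≤ t) : UpTreeVertex t :=
  ⟨(u.length, binaryCode u + 1), hu, by simp, binaryCode_lt u⟩

theorem upTreeVertexOfList_inj {t : ℕ} {u v : List Bool} {hu : u.length ≤ t} {hv : v.length ≤ t}
    (h : upTreeVertexOfList u hu = upTreeVertexOfList v hv) : u = v := by
  simp only [upTreeVertexOfList, Subtype.mk.injEq, Prod.mk.injEq, add_left_inj] at h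
  exact eq_of_binaryCode_eq h.1 h.2

theorem upTree_adj_cons {t : ℕ} (b : Bool) (u : List Bool) (hb : (b :: u).length ≤ t)
    (hu : u.length ≤ t) :
    (upTree t).Adj (upTreeVertexOfList (b :: u) hb) (upTreeVertexOfList u hu) := by
  refine ⟨rfl, ?_⟩
  simp only [upTreeVertexOfList, binaryCode]
  cases b <;> simp <;> omega

/-- Coinciding points would be equidistant from a third one. For `n = 2` there is a single pair and
nothing prevents distance zero. -/
theorem injective_of_dist_ne {n : ℕ} (hn : 3 ≤ n) {X : Type*} [MetricSpace X] {A : Fin n → X}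
    (hA : ∀ i j k l : Fin n, i ≠ j → k ≠ l →
      dist (A i) (A j) = dist (A k) (A l) → s(i, j) = s(k, l)) : Function.Injective A := by
  intro i j hij
  by_contra hne
  obtain ⟨k, hk⟩ : ∃ k : Fin n, k ∉ ({i, j} : Finset (Fin n)) := by
    by_contra! hall
    have h1 := Finset.card_le_card (fun k _ => hall k : Finset.univ ⊆ ({i, j} : Finset (Fin n)))
    have h2 := Finset.card_le_two (a := i) (b := j)
    simp only [Finset.card_univ, Fintype.card_fin] at h1
    omega
  simp only [Finset.mem_insert, Finset.mem_singleton, not_or] at hk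
  have := hA i k j k (Ne.symm hk.1) (Ne.symm hk.2) (by rw [hij])
  rw [Sym2.eq_iff] at this
  tauto

theorem exists_isNearestParentTree {n : ℕ} {f : Fin n → Fin n} {E : Type*}
    [NormedAddCommGroup E] {t s : ℕ} (hs : 1 ≤ s) (hst : s ≤ t)
    (hcopy : ContainsDigraphCopy (functionalGraph f) (upTree t))
    (hf : ∀ i, f i ≠ i) {A : Fin n → E} (hA : ∀ i j k l : Fin n, i ≠ j → k ≠ l →
      dist (A i) (A j) = dist (A k) (A l) → s(i, j) = s(k, l))
    (hmin : ∀ i j : Fin n, i ≠ j → dist (A i) (A (f i)) ≤ dist (A i) (A j)) :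
    ∃ (x : List Bool → E) (r : List Bool → ℝ), IsNearestParentTree s x r := by
  obtain ⟨φ, hφ, hadj⟩ := hcopy
  let ψ : List Bool → Fin n := fun u =>
    if hu : u.length ≤ t then φ (upTreeVertexOfList u hu) else φ (upTreeVertexOfList [] (by simp))
  have hψ : ∀ u (hu : u.length ≤ t), ψ u = φ (upTreeVertexOfList u hu) := fun u hu => dif_pos hu
  have hψinj : ∀ u v : List Bool, u.length ≤ t → v.length ≤ t → u ≠ v → ψ u ≠ ψ v := by
    intro u v hu hv huv h
    rw [hψ u hu, hψ v hv] at h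
    exact huv (upTreeVertexOfList_inj (hφ h))
  have hparent : ∀ b u, (b :: u).length ≤ t → f (ψ (b :: u)) = ψ u := by
    intro b u hb
    have hu : u.length ≤ t := by simp at hb; omega
    rw [hψ _ hb, hψ _ hu]
    exact hadj _ _ (upTree_adj_cons b u hb hu)
  have hn : 3 ≤ n := by
    have h1 := hψinj [] [true] (by simp) (by simp; omega) (by simp)
    have h2 := hψinj [] [false] (by simp) (by simp; omega) (by simp)
    have h3 := hψinj [true] [false] (by simp; omega) (by simp; omega) (by simp)
    omega
  have hAinj := injective_of_dist_ne hn hA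
  refine ⟨fun u => A (ψ u), fun u => dist (A (ψ u)) (A (f (ψ u))), ?_, ?_, ?_⟩
  · intro u _
    exact dist_pos.2 fun h => hf _ (hAinj h).symm
  · intro b u hb
    rw [hparent b u (hb.trans hst), dist_eq_norm]
  · intro u v hu hv huv
    rw [← dist_eq_norm]
    exact hmin _ _ (hψinj u v (hu.trans hst) (hv.trans hst) huv)

theorem exists_depth_not_minRealizableIn (k : ℕ) :
    ∃ s : ℕ, ∀ (n : ℕ) (f : Fin n → Fin n) (t : ℕ), s ≤ t →
      ContainsDigraphCopy (functionalGraph f) (upTree t) →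
        ¬ MinRealizableIn f (EuclideanSpace ℝ (Fin k)) := by
  obtain ⟨L, hL⟩ := exists_pow_lt_two_pow k (5 ^ k)
  -- A deeper tree is truncated to exactly this depth, since `hL` bounds the packing number only for
  -- this value.
  refine ⟨(5 ^ k + L + 1) * (L + 1), fun n f t ht hcopy ⟨hf, A, hA, hmin⟩ => ?_⟩
  obtain ⟨x, r, h⟩ := exists_isNearestParentTree (Nat.mul_pos (by positivity) (by omega)) ht hcopy hf
    hA hmin
  exact not_isNearestParentTree (by simpa using hL) (by simp) x r h

/-! ### A min-realizable function of in-degree at most 2 -/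

/-- Given a symmetric assignment of weights in `[0, K]` to pairs, the metric in which distinct points
`i, j` have distance `K + w i j`. -/
noncomputable abbrev metricSpaceOfWeight {α : Type*} [DecidableEq α] (w : α → α → ℝ) (K : ℝ)
    (hK : 0 < K) (h0 : ∀ i j, 0 ≤ w i j) (hw : ∀ i j, w i j ≤ K)
    (hsymm : ∀ i j, w i j = w j i) : MetricSpace α where
  dist i j := if i = j then 0 else K + w i j
  dist_self i := by simp
  dist_comm i j := by simp only [hsymm i j, eq_comm]
  dist_triangle i j k := by
    have h1 := h0 i j
    have h2 := h0 j k
    have h3 := hw i k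
    by_cases hij : i = j
    · subst hij; simp
    · by_cases hjk : j = k
      · subst hjk; simp
      · by_cases hik : i = k
        · simp only [hik, hjk, if_true, if_false]
          rw [if_neg (fun h => hjk h.symm)]
          linarith [h0 k j]
        · simp only [hij, hjk, hik, if_false]
          linarith
  eq_of_dist_eq_zero {i j} h := by
    by_contra hij
    simp only [hij, if_false] at h
    linarith [h0 i j]

/-- If `f` maps every index other than `0` to a smaller one and `f 0 = 1`, then `f` is
min-realizable. -/
theorem minRealizable_of_apply_lt {n : ℕ} (f : Fin n → Fin n)
    (hlt : ∀ i : Fin n, 1 ≤ i.val → (f i).val < i.val)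
    (h0 : ∀ i : Fin n, i.val = 0 → (f i).val = 1) : MinRealizable f := by
  -- For `i < j`, an edge weighs its larger endpoint `j`; a non-edge weighs at least `n`, with `(i,
  -- j)` encoded in base `n`. At `i ≥ 1` the edge to `f i` weighs `i`, and edges from preimages
  -- above `i` weigh more.
  let v : Fin n → Fin n → ℕ := fun i j =>
    if f j = i then j.val else n + (n * i.val + j.val)
  let w : Fin n → Fin n → ℕ := fun i j => v (min i j) (max i j)
  have hv : ∀ i j, v i j ≤ n + n * n + n := by
    intro i j
    have h1 := i.2
    have h2 := j.2
    have h3 : n * i.val ≤ n * n := Nat.mul_le_mul_left _ h1.le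
    simp only [v]
    split_ifs <;> omega
  have hsymm : ∀ i j, w i j = w j i := fun i j => by simp only [w, min_comm, max_comm]
  have hvinj : ∀ i j k l : Fin n, i < j → k < l → v i j = v k l → i = k ∧ j = l := by
    intro i j k l hij hkl h
    have hj := j.2
    have hl := l.2
    simp only [v] at h
    split_ifs at h with h1 h2 h2
    · have : j = l := Fin.ext h
      exact ⟨by rw [← h1, ← h2, this], this⟩
    · omega
    · omega
    · have h3 : n * i.val + j.val = n * k.val + l.val := by omega
      have hn : 0 < n := by omega
      have h4 := congrArg (· / n) h3
      have h5 := congrArg (· % n) h3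
      simp only [Nat.mul_add_div hn, Nat.div_eq_of_lt hj, Nat.div_eq_of_lt hl, Nat.mul_add_mod,
        Nat.mod_eq_of_lt hj, Nat.mod_eq_of_lt hl] at h4 h5
      exact ⟨Fin.ext (by omega), Fin.ext h5⟩
  have hfix : ∀ i, f i ≠ i := by
    intro i hi
    have h1 := h0 i
    have h2 := hlt i
    rw [hi] at h1 h2
    omega
  have hwinj : ∀ i j k l : Fin n, i ≠ j → k ≠ l → w i j = w k l → s(i, j) = s(k, l) := by
    intro i j k l hij hkl h
    obtain ⟨h1, h2⟩ := hvinj _ _ _ _ (min_lt_max.2 hij) (min_lt_max.2 hkl) h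
    rw [Sym2.eq_iff]
    rcases le_total i j with a | a <;> rcases le_total k l with b | b <;>
      simp only [min_eq_left, min_eq_right, max_eq_left, max_eq_right, a, b] at h1 h2 <;> tauto
  have hwmin : ∀ i j : Fin n, i ≠ j → w i (f i) ≤ w i j := by
    intro i j hij
    have hf1 : ∀ a : Fin n, a.val = 1 → (f a).val = 0 := fun a ha => by
      have := hlt a; omega
    have hwi : w i (f i) = max i.val 1 := by
      by_cases hi : i.val = 0
      · have h1 := h0 i hi
        have hle : i ≤ f i := Fin.le_def.2 (by omega)
        have h2 : f (f i) = i := Fin.ext (by rw [hf1 _ h1, hi])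
        simp only [w, v, min_eq_left hle, max_eq_right hle, if_pos h2]
        omega
      · have h1 := hlt i (by omega)
        have hle : f i ≤ i := Fin.le_def.2 (by omega)
        simp only [w, v, min_eq_right hle, max_eq_left hle, if_true]
        omega
    rw [hwi]
    have hij' : i.val ≠ j.val := fun h => hij (Fin.ext h)
    have hi := i.2
    have hj := j.2
    rcases le_total i j with a | a
    · have a' := Fin.le_def.1 a
      simp only [w, v, min_eq_left a, max_eq_right a]
      split_ifs <;> omega
    · have a' := Fin.le_def.1 a
      simp only [w, v, min_eq_right a, max_eq_left a]
      split_ifs <;> omega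
  refine ⟨Fin n, metricSpaceOfWeight (fun i j => (w i j : ℝ)) (n + n * n + n + 1 : ℕ)
    (by positivity) (fun i j => by positivity) (fun i j => ?_) (fun i j => by rw [hsymm]), ?_⟩
  · have : w i j ≤ n + n * n + n + 1 := (hv _ _).trans (by omega)
    exact_mod_cast this
  · refine ⟨hfix, id, fun i j k l hij hkl h => ?_, fun i j hij => ?_⟩
    · simp only [dist, id, hij, hkl, if_false, add_right_inj] at h
      exact hwinj i j k l hij hkl (by exact_mod_cast h)
    · simp only [dist, id, hij, (hfix i).symm, if_false, add_le_add_iff_left]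
      exact_mod_cast hwmin i j hij

/-- The map on `{0, …, 2 ^ (t + 1)}` exchanging `0` and `1` and sending `i ≥ 2` to `⌈i / 2⌉`. -/
def halvingMap (t : ℕ) (i : Fin (2 ^ (t + 1) + 1)) : Fin (2 ^ (t + 1) + 1) :=
  if i.val = 0 then ⟨1, by have := Nat.two_pow_pos (t + 1); omega⟩
  else if i.val = 1 then ⟨0, Nat.succ_pos _⟩
  else ⟨(i.val + 1) / 2, by have := i.2; omega⟩

theorem halvingMap_val (t : ℕ) (i : Fin (2 ^ (t + 1) + 1)) :
    (halvingMap t i).val = if i.val = 0 then 1 else if i.val = 1 then 0 else (i.val + 1) / 2 := by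
  unfold halvingMap
  split_ifs <;> rfl

theorem minRealizable_halvingMap (t : ℕ) : MinRealizable (halvingMap t) := by
  refine minRealizable_of_apply_lt _ (fun i hi => ?_) (fun i hi => ?_)
  · rw [halvingMap_val]
    split_ifs <;> omega
  · rw [halvingMap_val, if_pos hi]

theorem digraphInDegree_halvingMap_le (t : ℕ) (v : Fin (2 ^ (t + 1) + 1)) :
    digraphInDegree (functionalGraph (halvingMap t)) v ≤ 2 := by
  have hsub : Fin.val '' {w | (functionalGraph (halvingMap t)).Adj w v} ⊆
      ((if v.val = 0 then {1} else if v.val = 1 then {0, 2} else {2 * v.val - 1, 2 * v.val} :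
        Finset ℕ) : Set ℕ) := by
    rintro _ ⟨w, hw, rfl⟩
    have h := congrArg Fin.val (show halvingMap t w = v from hw)
    rw [halvingMap_val] at h
    split_ifs at h ⊢ <;>
      simp only [Finset.mem_coe, Finset.mem_insert, Finset.mem_singleton] <;> omega
  unfold digraphInDegree
  rw [← Set.ncard_image_of_injective _ Fin.val_injective]
  refine (Set.ncard_le_ncard hsub (Finset.finite_toSet _)).trans ?_
  rw [Set.ncard_coe_finset]
  split_ifs
  · simp
  · exact Finset.card_le_two
  · exact Finset.card_le_two

theorem containsDigraphCopy_halvingMap (t : ℕ) :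
    ContainsDigraphCopy (functionalGraph (halvingMap t)) (upTree t) := by
  have hlt : ∀ u : UpTreeVertex t, 2 ^ u.1.1 + u.1.2 < 2 ^ (t + 1) + 1 := by
    rintro ⟨⟨i, j⟩, hi, -, hj⟩
    have h1 : 2 ^ i ≤ 2 ^ t := Nat.pow_le_pow_right two_pos hi
    have h2 : j ≤ 2 ^ i := hj
    change 2 ^ i + j < 2 ^ (t + 1) + 1
    rw [pow_succ]
    omega
  -- Level `i` occupies `2^i + 1, …, 2^(i+1)`, so the root is `2` and the parent is the half rounded
  -- up. Subtracting 1 makes the binary logarithm recover the level.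
  refine ⟨fun u => ⟨2 ^ u.1.1 + u.1.2, hlt u⟩, ?_, ?_⟩
  · have hlog : ∀ u : UpTreeVertex t, Nat.log 2 (2 ^ u.1.1 + u.1.2 - 1) = u.1.1 := by
      rintro ⟨⟨i, j⟩, -, hj, hj'⟩
      have h1 : 1 ≤ j := hj
      have h2 : j ≤ 2 ^ i := hj'
      change Nat.log 2 (2 ^ i + j - 1) = i
      refine Nat.log_eq_of_pow_le_of_lt_pow (by omega) ?_
      rw [pow_succ]
      omega
    intro u v huv
    have h : 2 ^ u.1.1 + u.1.2 = 2 ^ v.1.1 + v.1.2 := congrArg Fin.val huv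
    have h1 : u.1.1 = v.1.1 := by rw [← hlog u, ← hlog v, h]
    rw [h1] at h
    exact Subtype.ext (Prod.ext h1 (by omega))
  · rintro ⟨⟨i, j⟩, hi, hj1, hj2⟩ ⟨⟨i', j'⟩, hi', hj1', hj2'⟩ ⟨h1, h2⟩
    simp only at *
    subst h1
    have := Nat.two_pow_pos i'
    refine Fin.ext ?_
    rw [halvingMap_val]
    simp only [pow_succ] at *
    split_ifs <;> omega

theorem theorem5 (k : ℕ) (hk : 0 < k) :
    (∃ s : ℕ, ∀ (n : ℕ) (f : Fin n → Fin n) (t : ℕ), s ≤ t →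
      ContainsDigraphCopy (functionalGraph f) (upTree t) →
        ¬ MinRealizableIn f (EuclideanSpace ℝ (Fin k))) ∧
    (∃ (n : ℕ) (f : Fin n → Fin n),
      MinRealizable f ∧
      (∀ v, digraphInDegree (functionalGraph f) v ≤ 2) ∧
      ¬ MinRealizableIn f (EuclideanSpace ℝ (Fin k))) := by
  obtain ⟨s, hs⟩ := exists_depth_not_minRealizableIn k
  exact ⟨⟨s, hs⟩, _, halvingMap s, minRealizable_halvingMap s, digraphInDegree_halvingMap_le s,
    hs _ _ s le_rfl (containsDigraphCopy_halvingMap s)⟩
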